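/- Let $k$ be an algebraically closed field and let $S=\bigoplus_{i\ge 0}S_i$ be a homogeneous graded $k$-algebra (that is, $S_0=k$, $\dim_k S_1<\infty$, and $S$ is generated as a $k$-algebra by $S_1$), with graded maximal ideal $\mathfrak n=\bigoplus_{i\ge 1}S_i$. Assume that $S$ is Cohen–Macaulay of Krull dimension one and that it has minimal multiplicity, i.e. the local ring $(A,\mathfrak m)=(S_{\mathfrak n},\mathfrak n S_{\mathfrak n})$ has a parameter $x$ with $x\mathfrak m=\mathfrak m^2$. Let $f\in S_2$ be a non-zero-divisor of $S$, put $R=S/fS$, let $V=R_1$ be the $k$-vector space of elements of degree one of $R$, and assume $\dim_k V\ge 2$ (this is automatic if $R$ is not Gorenstein). Let $\mathbb P(V)$ be the set of one-dimensional $k$-subspaces of $V$ with the Zariski topology. For $x,z\in V$ and an integer $n\ge 1$, let $\Phi_{x,z,n}$ be the $n\times n$ matrix over $R$ with every diagonal entry equal to $x$, every entry directly above the diagonal equal to $z$, and all other entries $0$. A finitely generated $R$-module $M$ is said to have G-dimension zero if the natural map $M\to \operatorname{Hom}_R(\operatorname{Hom}_R(M,R),R)$ is an isomorphism and $\operatorname{Ext}^i_R(M,R)=0=\operatorname{Ext}^i_R(\operatorname{Hom}_R(M,R),R)$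 for all $i>0$. Then for every nonzero $z\in V$ there are a nonempty open subset $\mathcal O\subseteq\mathbb P(V)$ and $R$-modules $M(p,n)$, for $p\in\mathcal O$ and integers $n\ge 1$, such that: (0) for every nonzero $x\in V$ with $[x]\in\mathcal O$ and every $n\ge1$, $M([x],n)\cong\operatorname{Coker}(\Phi_{x,z,n}\colon R^n\to R^n)$; (1) each $M(p,n)$ is an indecomposable $R$-module that is minimally generated by $n$ elements; (2) each $M(p,n)$ has G-dimension zero; (3) if $(p,n)\ne(p',n')$, then $M(p,n)$ and $M(p',n')$ are not isomorphic as $R$-modules. -/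

import Mathlib

open CategoryTheory LinearAlgebra.Projectivization
open scoped Topology

universe u v

/-! ### Commutative algebra: Cohen-Macaulay rings and minimal multiplicity -/

/-- A Noetherian local ring is Cohen-Macaulay if its maximal ideal contains a regular sequence
whose length is the Krull dimension of the ring. -/
def IsCohenMacaulayLocalRing (A : Type u) [CommRing A] [IsLocalRing A] : Prop :=
  IsNoetherianRing A ∧
    ∃ xs : List A, (∀ x ∈ xs, x ∈ IsLocalRing.maximalIdeal A) ∧
      RingTheory.Sequence.IsRegular A xs ∧
      ringKrullDim A = ((xs.length : ℕ) : WithBot ℕ∞)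

/-- A Noetherian ring is Cohen-Macaulay if all its localizations at maximal ideals are. -/
def IsCohenMacaulayRing (A : Type u) [CommRing A] : Prop :=
  IsNoetherianRing A ∧
    ∀ (m : Ideal A) [m.IsMaximal], IsCohenMacaulayLocalRing (Localization.AtPrime m)

/-- `xs` is a system of parameters of the local ring `A`: it has `dim A` members and generates an
ideal that is primary to the maximal ideal. -/
def IsSystemOfParameters (A : Type u) [CommRing A] [IsLocalRing A] (xs : List A) : Prop :=
  ringKrullDim A = ((xs.length : ℕ) : WithBot ℕ∞) ∧
    (Ideal.ofList xs).radical = IsLocalRing.maximalIdeal A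

/-- A (Cohen-Macaulay) local ring `(A, m)` has minimal multiplicity if there is a system of
parameters `x₁, …, x_d` with `(x₁, …, x_d) m = m ^ 2`. -/
def HasMinimalMultiplicity (A : Type u) [CommRing A] [IsLocalRing A] : Prop :=
  ∃ xs : List A, IsSystemOfParameters A xs ∧
    Ideal.ofList xs * IsLocalRing.maximalIdeal A = IsLocalRing.maximalIdeal A ^ 2

section Graded

variable {k : Type v} {S : Type u} [Field k] [CommRing S] [Algebra k S]

/-- A homogeneous graded ring over `k`, that is, a graded quotient of a polynomial ring over `k` in
finitely many variables of degree one: the degree zero part is `k` and the algebra is generated by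
its degree one part, which has finite dimension. -/
structure IsHomogeneousGradedRing (𝒮 : ℕ → Submodule k S) [GradedAlgebra 𝒮] : Prop where
  nontrivial : Nontrivial S
  degree_zero : 𝒮 0 = LinearMap.range (Algebra.linearMap k S)
  finite_degree_one : Module.Finite k (𝒮 1)
  adjoin_degree_one : Algebra.adjoin k (𝒮 1 : Set S) = ⊤

/-- A homogeneous graded ring has minimal multiplicity if its localization at the graded maximal
ideal, the ideal of the elements with no constant term, has minimal multiplicity. -/
def HasGradedMinimalMultiplicity (𝒮 : ℕ → Submodule k S) [GradedAlgebra 𝒮] : Prop :=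
  ∃ _ : (HomogeneousIdeal.irrelevant 𝒮).toIdeal.IsPrime,
    HasMinimalMultiplicity (Localization.AtPrime (HomogeneousIdeal.irrelevant 𝒮).toIdeal)

/-- The degree one part of the graded ring `S / f S`: the classes of the elements of degree one. -/
def quotientDegreeOne (𝒮 : ℕ → Submodule k S) (f : S) : Submodule k (S ⧸ Ideal.span {f}) :=
  (𝒮 1).map (Ideal.Quotient.mkₐ k (Ideal.span {f})).toLinearMap

end Graded

/-! ### The Zariski topology on the projective space of lines of a vector space -/

/-- The Zariski topology on `ℙ k V`, which has as a basis the sets of the lines on which a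
homogeneous polynomial does not vanish.  Polynomial functions on `V` are written, without a choice
of a basis, as polynomials in the linear forms on `V`. -/
abbrev zariskiTopology (k : Type v) (V : Type u) [Field k] [AddCommGroup V] [Module k V] :
    TopologicalSpace (ℙ k V) :=
  TopologicalSpace.generateFrom
    {U | ∃ (d : ℕ) (P : MvPolynomial (Module.Dual k V) k), P.IsHomogeneous d ∧
      U = {p : ℙ k V | MvPolynomial.eval (fun φ : Module.Dual k V => φ p.rep) P ≠ 0}}

/-! ### Modules -/

/-- A module of G-dimension zero (over a Noetherian ring `R`): a finitely generated reflexive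
module `M` with `Ext ^ i (M, R) = 0` and `Ext ^ i (Hom (M, R), R) = 0` for all `i > 0`. -/
structure HasGDimZero (R : Type u) [CommRing R] (M : Type u) [AddCommGroup M] [Module R M] :
    Prop where
  finite : Module.Finite R M
  reflexive : Module.IsReflexive R M
  ext_eq_zero : ∀ i : ℕ, 0 < i →
    Subsingleton (Abelian.Ext.{u} (ModuleCat.of R M) (ModuleCat.of R R) i)
  ext_dual_eq_zero : ∀ i : ℕ, 0 < i →
    Subsingleton (Abelian.Ext.{u} (ModuleCat.of R (Module.Dual R M)) (ModuleCat.of R R) i)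

/-- A nonzero module is indecomposable if it is not the internal direct sum of two nonzero
submodules. -/
def IsIndecomposableModule (R : Type u) [CommRing R] (M : Type u) [AddCommGroup M] [Module R M] :
    Prop :=
  Nontrivial M ∧ ∀ N N' : Submodule R M, IsCompl N N' → N = ⊥ ∨ N' = ⊥

/-- `M` is minimally generated by `n` elements: `n` is the least number of elements that
generate `M`. -/
def IsMinimallyGeneratedBy (R : Type u) [CommRing R] (M : Type u) [AddCommGroup M] [Module R M]
    (n : ℕ) : Prop :=
  IsLeast {m : ℕ | ∃ g : Fin m → M, Submodule.span R (Set.range g) = ⊤} n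

/-- The `n × n` matrix with `x` on the diagonal, `z` directly above it and `0` elsewhere. -/
def bidiagonal {R : Type u} [CommRing R] (x z : R) (n : ℕ) : Matrix (Fin n) (Fin n) R :=
  Matrix.of fun i j => if i = j then x else if (i : ℕ) + 1 = (j : ℕ) then z else 0

/-- The cokernel of a square matrix, acting on column vectors. -/
abbrev matrixCokernel {R : Type u} [CommRing R] {n : ℕ} (A : Matrix (Fin n) (Fin n) R) : Type u :=
  (Fin n → R) ⧸ LinearMap.range A.mulVecLin

/-!
The proof is elementary and works with components of degree at most three.

Clearing denominators in `x 𝔪 = 𝔪²` and comparing components of degree two gives a linear form `y`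
with `y S₁ = S₂` (`IsHomogeneousGradedRing.exists_degree_two_le`). Since `f ∈ S₂` is a
non-zero-divisor, multiplication by any such `y` is a bijection `S₁ → S₂`, so `y S₁ = S₂` is the
nonvanishing of a determinant. The open set `𝒪` consists of the lines spanned by such forms, with
the line of `z` removed; it is nonempty because `k` is infinite and `dim V ≥ 2`.

*G-dimension zero.* If `x S₁ = S₂`, there are linear forms `w_i` with `f = x w₀` and
`z w_i = x w_{i+1}`. With `N` the nilpotent Jordan block, `Φ = x + z N` and
`Ψ = ∑ (-1)ⁱ w_i Nⁱ` satisfy `Φ Ψ = Ψ Φ = f`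
(`exists_matrixFactorization_bidiagonal`). Modulo `f` the two matrices form a periodic exact complex
whose dual is exact too (`isExactMatrixPair_of_matrixFactorization`), and dimension shifting gives
`IsExactMatrixPair.hasGDimZero`.

*Indecomposability and isomorphism classes.* A homomorphism `coker Φ → coker Φ'` lifts to matrices
with `A Φ = Φ' B`, and the components of degree one of this identity are relations between the
constant parts `A₀`, `B₀` and `N` over `k`. For an idempotent endomorphism they say that `A₀` is an
idempotent commuting with `N`, hence `0` or `1`; as the augmentation ideal of `R` is
nilpotent, the endomorphism is `0` or the identity (`IsDegreeOnePart.isIndecomposableModule`). For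
an isomorphism between the modules of two different lines they force `A₀` to be singular
(`IsDegreeOnePart.mem_span_of_equiv`). Nilpotence of the augmentation ideal holds because every
product of three linear forms is a multiple of `f`.
-/

/-! ### Exact pairs of matrices and G-dimension zero -/

section DimensionShift

variable {C : Type*} [Category C] [Abelian C] [HasExt.{u} C] {T : ShortComplex C}

/-- `Ext¹(X₃, Y)` is the cokernel of `Hom(X₂, Y) → Hom(X₁, Y)` when `X₂` is projective. -/
theorem subsingleton_ext_one_of_forall_extends (hT : T.ShortExact) [Projective T.X₂] {Y : C}
    (h : ∀ g : T.X₁ ⟶ Y, ∃ g' : T.X₂ ⟶ Y, T.f ≫ g' = g) :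
    Subsingleton (Abelian.Ext.{u} T.X₃ Y 1) := by
  refine subsingleton_of_forall_eq 0 fun e => ?_
  obtain ⟨e', rfl⟩ := Abelian.Ext.contravariant_sequence_exact₃ hT _ e
    (Abelian.Ext.eq_zero_of_projective _) (n₀ := 0) rfl
  obtain ⟨g, rfl⟩ := Abelian.Ext.addEquiv₀.symm.surjective e'
  obtain ⟨g', rfl⟩ := h g
  simp only [Abelian.Ext.addEquiv₀_symm_apply]
  rw [← Abelian.Ext.mk₀_comp_mk₀, hT.extClass_comp_assoc]

theorem subsingleton_ext_succ_of_shortExact (hT : T.ShortExact) [Projective T.X₂] {Y : C} {i : ℕ}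
    (h : Subsingleton (Abelian.Ext.{u} T.X₁ Y i)) :
    Subsingleton (Abelian.Ext.{u} T.X₃ Y (i + 1)) := by
  refine subsingleton_of_forall_eq 0 fun e => ?_
  obtain ⟨e', rfl⟩ := Abelian.Ext.contravariant_sequence_exact₃ hT _ e
    (Abelian.Ext.eq_zero_of_projective _) (n₀ := i) (by omega)
  rw [Subsingleton.elim e' 0, Abelian.Ext.comp_zero]

end DimensionShift

/-- Two square matrices form an exact pair if, alternately repeated, they form an exact complex of
free modules which stays exact after dualizing. -/
structure IsExactMatrixPair {R : Type u} [CommRing R] {n : ℕ} (Φ Ψ : Matrix (Fin n) (Fin n) R) :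
    Prop where
  ker_left : LinearMap.ker Φ.mulVecLin = LinearMap.range Ψ.mulVecLin
  ker_right : LinearMap.ker Ψ.mulVecLin = LinearMap.range Φ.mulVecLin
  ker_left_transpose : LinearMap.ker Φ.transpose.mulVecLin = LinearMap.range Ψ.transpose.mulVecLin
  ker_right_transpose : LinearMap.ker Ψ.transpose.mulVecLin = LinearMap.range Φ.transpose.mulVecLin

namespace IsExactMatrixPair

variable {R : Type u} [CommRing R] {n : ℕ} {Φ Ψ : Matrix (Fin n) (Fin n) R}

theorem symm (h : IsExactMatrixPair Φ Ψ) : IsExactMatrixPair Ψ Φ :=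
  ⟨h.ker_right, h.ker_left, h.ker_right_transpose, h.ker_left_transpose⟩

theorem transpose (h : IsExactMatrixPair Φ Ψ) : IsExactMatrixPair Φ.transpose Ψ.transpose :=
  ⟨h.ker_left_transpose, h.ker_right_transpose, by simpa using h.ker_left,
    by simpa using h.ker_right⟩

theorem exists_of_mulVec_eq_zero (h : IsExactMatrixPair Φ Ψ) {v : Fin n → R}
    (hv : Φ.mulVec v = 0) : ∃ w, Ψ.mulVec w = v := by
  have : v ∈ LinearMap.range Ψ.mulVecLin := h.ker_left ▸ hv
  exact this

/-- The inclusion of the first syzygy `coker Ψ ≅ im Φ` of `coker Φ` into the free module. -/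
def syzygy (h : IsExactMatrixPair Φ Ψ) : matrixCokernel Ψ →ₗ[R] (Fin n → R) :=
  (LinearMap.range Ψ.mulVecLin).liftQ Φ.mulVecLin h.ker_left.ge

theorem syzygy_mk (h : IsExactMatrixPair Φ Ψ) (v : Fin n → R) :
    h.syzygy (Submodule.Quotient.mk v) = Φ.mulVec v := rfl

theorem syzygy_injective (h : IsExactMatrixPair Φ Ψ) : Function.Injective h.syzygy := by
  rw [← LinearMap.ker_eq_bot]
  exact Submodule.ker_liftQ_eq_bot _ _ _ h.ker_left.le

theorem exact_syzygy (h : IsExactMatrixPair Φ Ψ) :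
    Function.Exact h.syzygy (LinearMap.range Φ.mulVecLin).mkQ := by
  rw [LinearMap.exact_iff, Submodule.ker_mkQ, syzygy, Submodule.range_liftQ]

/-- The linear form on `coker Ψ` induced by a linear form `w` on the free module via the
syzygy map. -/
def dualMap (h : IsExactMatrixPair Φ Ψ) : (Fin n → R) →ₗ[R] Module.Dual R (matrixCokernel Ψ) :=
  (LinearMap.lcomp R R h.syzygy) ∘ₗ dotProductBilin R R

theorem dualMap_apply (h : IsExactMatrixPair Φ Ψ) (w : Fin n → R) (m : matrixCokernel Ψ) :
    h.dualMap w m = w ⬝ᵥ h.syzygy m := rfl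

/-- Every linear form on the syzygy module extends to the free module: this is exactness of the
transposed pair. -/
theorem dualMap_surjective (h : IsExactMatrixPair Φ Ψ) : Function.Surjective h.dualMap := by
  intro g
  set u : Fin n → R := fun i => g (Submodule.Quotient.mk (Pi.single i 1)) with hu
  have hg : ∀ v : Fin n → R, g (Submodule.Quotient.mk v) = u ⬝ᵥ v := by
    intro v
    have := LinearMap.pi_apply_eq_sum_univ (g ∘ₗ (LinearMap.range Ψ.mulVecLin).mkQ) v
    simp only [LinearMap.comp_apply, Submodule.mkQ_apply] at this
    rw [this]
    refine Finset.sum_congr rfl fun i _ => ?_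
    simp only [hu, smul_eq_mul, mul_comm (v i)]
    congr 3
    ext j
    simp [Pi.single_apply, eq_comm]
  have h0 : Ψ.transpose.mulVec u = 0 := by
    rw [Matrix.mulVec_transpose]
    ext j
    have h1 := hg (Ψ.mulVec (Pi.single j 1))
    have h2 : (Submodule.Quotient.mk (Ψ.mulVec (Pi.single j 1)) : matrixCokernel Ψ) = 0 :=
      (Submodule.Quotient.mk_eq_zero _).2 (LinearMap.mem_range_self Ψ.mulVecLin _)
    rw [h2, map_zero, Matrix.dotProduct_mulVec] at h1
    simpa using h1.symm
  obtain ⟨w, hw⟩ := h.symm.transpose.exists_of_mulVec_eq_zero h0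
  refine ⟨w, ?_⟩
  refine LinearMap.ext fun m => ?_
  obtain ⟨v, rfl⟩ := Submodule.Quotient.mk_surjective _ m
  rw [dualMap_apply, syzygy_mk, hg, Matrix.dotProduct_mulVec, ← hw, Matrix.mulVec_transpose]

theorem ker_dualMap (h : IsExactMatrixPair Φ Ψ) :
    LinearMap.ker h.dualMap = LinearMap.range Ψ.transpose.mulVecLin := by
  rw [← h.ker_left_transpose]
  ext w
  simp only [LinearMap.mem_ker, Matrix.mulVecLin_apply, Matrix.mulVec_transpose]
  constructor
  · intro hw
    ext j
    have := LinearMap.congr_fun hw (Submodule.Quotient.mk (Pi.single j 1))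
    rw [dualMap_apply, syzygy_mk, Matrix.dotProduct_mulVec] at this
    simpa using this
  · intro hw
    refine LinearMap.ext fun m => ?_
    obtain ⟨v, rfl⟩ := Submodule.Quotient.mk_surjective _ m
    rw [dualMap_apply, syzygy_mk, Matrix.dotProduct_mulVec, hw, zero_dotProduct]
    rfl

/-- The dual of the cokernel is the cokernel of the transpose. -/
noncomputable def cokernelTransposeEquivDual (h : IsExactMatrixPair Φ Ψ) :
    matrixCokernel Ψ.transpose ≃ₗ[R] Module.Dual R (matrixCokernel Ψ) :=
  (Submodule.quotEquivOfEq _ _ h.ker_dualMap.symm).trans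
    (h.dualMap.quotKerEquivOfSurjective h.dualMap_surjective)

/-- A linear form `H` on the dual pulls back along `dualMap` to a vector `u` with `Ψ u = 0`, so that
`u = Φ v` and `H` is evaluation at the class of `v`. -/
theorem isReflexive (h : IsExactMatrixPair Φ Ψ) : Module.IsReflexive R (matrixCokernel Ψ) := by
  refine ⟨⟨?_, fun H => ?_⟩⟩
  · rw [← LinearMap.ker_eq_bot, LinearMap.ker_eq_bot']
    intro m hm
    apply h.syzygy_injective
    rw [map_zero]
    ext i
    have := LinearMap.congr_fun hm (h.dualMap (Pi.single i 1))
    rw [Module.Dual.eval_apply, dualMap_apply] at this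
    simpa using this
  · set u : Fin n → R := fun i => H (h.dualMap (Pi.single i 1)) with hu
    have hH : ∀ w : Fin n → R, H (h.dualMap w) = w ⬝ᵥ u := by
      intro w
      have := LinearMap.pi_apply_eq_sum_univ (H ∘ₗ h.dualMap) w
      simp only [LinearMap.comp_apply] at this
      rw [this]
      refine Finset.sum_congr rfl fun i _ => ?_
      simp only [hu, smul_eq_mul]
      congr 3
      ext j
      simp [Pi.single_apply, eq_comm]
    have h0 : Ψ.mulVec u = 0 := by
      ext j
      have h2 : Ψ.transpose.mulVec (Pi.single j 1) ∈ LinearMap.ker h.dualMap :=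
        h.ker_dualMap ▸ LinearMap.mem_range_self Ψ.transpose.mulVecLin _
      have h1 := hH (Ψ.transpose.mulVec (Pi.single j 1))
      rw [LinearMap.mem_ker.1 h2, map_zero, Matrix.mulVec_transpose,
        ← Matrix.dotProduct_mulVec] at h1
      simpa using h1.symm
    obtain ⟨v, hv⟩ := h.symm.exists_of_mulVec_eq_zero h0
    refine ⟨Submodule.Quotient.mk v, ?_⟩
    ext g
    obtain ⟨w, rfl⟩ := h.dualMap_surjective g
    rw [Module.Dual.eval_apply, dualMap_apply, syzygy_mk, hH, hv]

/-- The syzygy of `coker Φ` is `coker Ψ`, so the Ext groups of all these cokernels vanish together by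
dimension shifting. -/
theorem subsingleton_ext (i : ℕ) : ∀ {Φ Ψ : Matrix (Fin n) (Fin n) R},
    IsExactMatrixPair Φ Ψ → Subsingleton (Abelian.Ext.{u} (ModuleCat.of R (matrixCokernel Φ))
      (ModuleCat.of R R) (i + 1)) := by
  induction i with
  | zero =>
    intro Φ Ψ h
    let T : ShortComplex (ModuleCat.{u} R) :=
      ShortComplex.moduleCatMk h.syzygy (LinearMap.range Φ.mulVecLin).mkQ
        h.exact_syzygy.linearMap_comp_eq_zero
    have hT : T.ShortExact := ModuleCat.shortComplex_shortExact T h.exact_syzygy h.syzygy_injective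
      (Submodule.mkQ_surjective _)
    have : Projective T.X₂ := ModuleCat.projective_of_free (Pi.basisFun R (Fin n))
    refine subsingleton_ext_one_of_forall_extends hT fun g => ?_
    obtain ⟨w, hw⟩ := h.dualMap_surjective g.hom
    exact ⟨ModuleCat.ofHom (dotProductBilin R R w), ModuleCat.hom_ext hw⟩
  | succ i ih =>
    intro Φ Ψ h
    let T : ShortComplex (ModuleCat.{u} R) :=
      ShortComplex.moduleCatMk h.syzygy (LinearMap.range Φ.mulVecLin).mkQ
        h.exact_syzygy.linearMap_comp_eq_zero
    have hT : T.ShortExact := ModuleCat.shortComplex_shortExact T h.exact_syzygy h.syzygy_injective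
      (Submodule.mkQ_surjective _)
    have : Projective T.X₂ := ModuleCat.projective_of_free (Pi.basisFun R (Fin n))
    exact subsingleton_ext_succ_of_shortExact hT (ih h.symm)

theorem hasGDimZero (h : IsExactMatrixPair Φ Ψ) : HasGDimZero R (matrixCokernel Φ) where
  finite := inferInstance
  reflexive := h.symm.isReflexive
  ext_eq_zero i hi := by
    obtain ⟨i, rfl⟩ := Nat.exists_eq_succ_of_ne_zero hi.ne'
    exact h.subsingleton_ext i
  ext_dual_eq_zero i hi := by
    obtain ⟨i, rfl⟩ := Nat.exists_eq_succ_of_ne_zero hi.ne'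
    have := h.transpose.subsingleton_ext i
    let e := ((Abelian.extFunctor.{u} (C := ModuleCat.{u} R) (i + 1)).mapIso
      (h.symm.cokernelTransposeEquivDual.toModuleIso).op).app (ModuleCat.of R R)
    exact @Equiv.subsingleton _ _ e.addCommGroupIsoToAddEquiv.toEquiv this

end IsExactMatrixPair

/-- A matrix factorization of a non-zero-divisor `f` becomes an exact pair modulo `f`. -/
theorem isExactMatrixPair_of_matrixFactorization {S : Type u} [CommRing S] {f : S}
    (hf : f ∈ nonZeroDivisors S) {n : ℕ} {A B : Matrix (Fin n) (Fin n) S}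
    (hAB : A * B = Matrix.scalar _ f) (hBA : B * A = Matrix.scalar _ f) :
    IsExactMatrixPair (A.map (Ideal.Quotient.mk (Ideal.span {f})))
      (B.map (Ideal.Quotient.mk (Ideal.span {f}))) := by
  have key : ∀ {A B : Matrix (Fin n) (Fin n) S}, A * B = Matrix.scalar _ f →
      B * A = Matrix.scalar _ f →
      LinearMap.ker (A.map (Ideal.Quotient.mk (Ideal.span {f}))).mulVecLin =
        LinearMap.range (B.map (Ideal.Quotient.mk (Ideal.span {f}))).mulVecLin := by
    intro A B hAB hBA
    have hmap : ∀ (A : Matrix (Fin n) (Fin n) S) (v : Fin n → S),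
        (A.map (Ideal.Quotient.mk (Ideal.span {f}))).mulVec
          (fun i => Ideal.Quotient.mk (Ideal.span {f}) (v i)) =
          fun i => Ideal.Quotient.mk (Ideal.span {f}) (A.mulVec v i) := by
      intro A v
      ext i
      exact (RingHom.map_mulVec (Ideal.Quotient.mk (Ideal.span {f})) A v i).symm
    have hlift : ∀ v : Fin n → S ⧸ Ideal.span {f},
        ∃ u : Fin n → S, v = fun i => Ideal.Quotient.mk (Ideal.span {f}) (u i) := by
      intro v
      choose u hu using fun i => Ideal.Quotient.mk_surjective (v i)
      exact ⟨u, funext fun i => (hu i).symm⟩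
    apply le_antisymm
    · intro v hv
      obtain ⟨v, rfl⟩ := hlift v
      rw [LinearMap.mem_ker, Matrix.mulVecLin_apply, hmap] at hv
      have hv' : ∀ i, ∃ c, A.mulVec v i = f * c := fun i =>
        Ideal.mem_span_singleton.1 (Ideal.Quotient.eq_zero_iff_mem.1 (congrFun hv i))
      choose u hu using hv'
      have hu' : A.mulVec v = f • u := funext hu
      refine ⟨fun i => Ideal.Quotient.mk (Ideal.span {f}) (u i), ?_⟩
      rw [Matrix.mulVecLin_apply, hmap]
      ext i
      congr 1
      have h1 : B.mulVec (A.mulVec v) = f • v := by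
        rw [Matrix.mulVec_mulVec, hBA]
        ext i
        simp [Matrix.scalar_apply, Matrix.mulVec_diagonal]
      rw [hu', Matrix.mulVec_smul] at h1
      have h2 := congrFun h1 i
      simp only [Pi.smul_apply, smul_eq_mul] at h2
      exact (mul_cancel_left_mem_nonZeroDivisors hf).1 h2
    · rintro _ ⟨v, rfl⟩
      obtain ⟨v, rfl⟩ := hlift v
      rw [LinearMap.mem_ker, Matrix.mulVecLin_apply, Matrix.mulVecLin_apply, hmap, hmap,
        Matrix.mulVec_mulVec, hAB]
      ext i
      refine Ideal.Quotient.eq_zero_iff_mem.2 (Ideal.mem_span_singleton.2 ⟨v i, ?_⟩)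
      simp [Matrix.scalar_apply, Matrix.mulVec_diagonal]
  have htr : ∀ {A B : Matrix (Fin n) (Fin n) S}, A * B = Matrix.scalar _ f →
      B.transpose * A.transpose = Matrix.scalar _ f := by
    intro A B h
    rw [← Matrix.transpose_mul, h]
    simp [Matrix.scalar_apply]
  refine ⟨key hAB hBA, key hBA hAB, ?_, ?_⟩
  · rw [← Matrix.transpose_map, ← Matrix.transpose_map]
    exact key (htr hBA) (htr hAB)
  · rw [← Matrix.transpose_map, ← Matrix.transpose_map]
    exact key (htr hAB) (htr hBA)

/-! ### Bidiagonal matrices and homomorphisms of cokernels -/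

section Bidiagonal

variable {R : Type u} [CommRing R] {n : ℕ}

theorem bidiagonal_eq_smul_add_smul (x z : R) (n : ℕ) :
    bidiagonal x z n = x • (1 : Matrix (Fin n) (Fin n) R) + z • bidiagonal 0 1 n := by
  ext i j
  simp only [bidiagonal, Matrix.of_apply, Matrix.add_apply, Matrix.smul_apply, Matrix.one_apply,
    smul_eq_mul]
  by_cases h : i = j
  · subst h; simp
  · by_cases h' : (i : ℕ) + 1 = j <;> simp [h, h']

theorem bidiagonal_zero_one_pow_apply_eq_zero (m : ℕ) :
    ∀ i j : Fin n, (j : ℕ) < i + m → ((bidiagonal (0 : R) 1 n) ^ m) i j = 0 := by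
  induction m with
  | zero =>
    intro i j h
    rw [pow_zero, Matrix.one_apply_ne]
    rintro rfl
    omega
  | succ m ih =>
    intro i j h
    rw [pow_succ, Matrix.mul_apply]
    refine Finset.sum_eq_zero fun l _ => ?_
    by_cases hl : (l : ℕ) + 1 = j
    · rw [ih i l (by omega), zero_mul]
    · simp [bidiagonal, hl]

theorem bidiagonal_zero_one_pow : (bidiagonal (0 : R) 1 n) ^ n = 0 := by
  ext i j
  exact bidiagonal_zero_one_pow_apply_eq_zero n i j (by omega)

theorem bidiagonal_zero_one_mulVec_single_zero (hn : 0 < n) :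
    (bidiagonal (0 : R) 1 n).mulVec (Pi.single ⟨0, hn⟩ 1) = 0 := by
  ext i
  simp [bidiagonal]

/-- The kernel of the nilpotent Jordan block is spanned by the first basis vector. -/
theorem eq_smul_single_of_bidiagonal_mulVec_eq_zero (hn : 0 < n) {v : Fin n → R}
    (hv : (bidiagonal (0 : R) 1 n).mulVec v = 0) :
    v = v ⟨0, hn⟩ • (Pi.single ⟨0, hn⟩ 1 : Fin n → R) := by
  ext j
  by_cases hj : j = ⟨0, hn⟩
  · subst hj; simp
  · have hj' : (j : ℕ) ≠ 0 := fun h => hj (Fin.ext h)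
    have h := congrFun hv ⟨(j : ℕ) - 1, by omega⟩
    rw [Matrix.mulVec, dotProduct, Finset.sum_eq_single j] at h
    · have h1 : (j : ℕ) - 1 + 1 = j := by omega
      simp only [bidiagonal, Matrix.of_apply, h1, if_true, Pi.zero_apply] at h
      have h2 : (⟨(j : ℕ) - 1, by omega⟩ : Fin n) ≠ j := fun h => by
        have := congrArg Fin.val h
        simp only at this
        omega
      simpa [hj, h2] using h
    · intro l _ hl
      have h1 : ¬ (j : ℕ) - 1 + 1 = l := fun h => hl (Fin.ext (by omega))
      simp [bidiagonal, h1]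
    · simp

/-- An idempotent commuting with `N` that kills the kernel of the nilpotent `N` vanishes. -/
theorem eq_zero_of_commute_bidiagonal (hn : 0 < n) {P : Matrix (Fin n) (Fin n) R}
    (hP : P * P = P) (hc : Commute P (bidiagonal (0 : R) 1 n))
    (h0 : P.mulVec (Pi.single ⟨0, hn⟩ 1) = 0) : P = 0 := by
  have key : ∀ j, j ≤ n → bidiagonal (0 : R) 1 n ^ (n - j) * P = 0 := by
    intro j
    induction j with
    | zero => intro _; rw [Nat.sub_zero, bidiagonal_zero_one_pow, zero_mul]
    | succ j ih =>
      intro hj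
      have h1 := ih (by omega)
      rw [show n - j = (n - (j + 1)) + 1 by omega, pow_succ', mul_assoc] at h1
      set Q := bidiagonal (0 : R) 1 n ^ (n - (j + 1)) * P with hQ
      have h2 : P * Q = Q := by
        rw [hQ, ← mul_assoc, (hc.pow_right _).eq, mul_assoc, hP]
      refine Matrix.ext_of_mulVec_single fun i => ?_
      have h3 : (bidiagonal (0 : R) 1 n).mulVec (Q.mulVec (Pi.single i 1)) = 0 := by
        rw [Matrix.mulVec_mulVec, h1, Matrix.zero_mulVec]
      rw [Matrix.zero_mulVec, ← h2, ← Matrix.mulVec_mulVec,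
        eq_smul_single_of_bidiagonal_mulVec_eq_zero hn h3, Matrix.mulVec_smul, h0, smul_zero]
  simpa using key n le_rfl

/-- The only idempotents commuting with a nilpotent Jordan block are `0` and `1`: such an idempotent
acts on the one-dimensional kernel of the block by `0` or `1`. -/
theorem eq_zero_or_eq_one_of_commute_bidiagonal [IsDomain R] (hn : 0 < n)
    {P : Matrix (Fin n) (Fin n) R} (hP : P * P = P)
    (hc : Commute P (bidiagonal (0 : R) 1 n)) : P = 0 ∨ P = 1 := by
  set e : Fin n → R := Pi.single ⟨0, hn⟩ 1 with he
  obtain ⟨c, h0⟩ : ∃ c : R, P.mulVec e = c • e := by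
    refine ⟨_, eq_smul_single_of_bidiagonal_mulVec_eq_zero hn ?_⟩
    rw [Matrix.mulVec_mulVec, ← hc.eq, ← Matrix.mulVec_mulVec, he,
      bidiagonal_zero_one_mulVec_single_zero, Matrix.mulVec_zero]
  have hcc : c * c = c := by
    have h1 : P.mulVec (P.mulVec e) = P.mulVec e := by rw [Matrix.mulVec_mulVec, hP]
    rw [h0, Matrix.mulVec_smul, h0, smul_smul] at h1
    simpa [he] using congrFun h1 ⟨0, hn⟩
  rcases IsIdempotentElem.iff_eq_zero_or_one.1 hcc with h | h
  · left
    exact eq_zero_of_commute_bidiagonal hn hP hc (by rw [← he, h0, h, zero_smul])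
  · right
    have hQ : (1 - P) * (1 - P) = 1 - P := by
      rw [sub_mul, one_mul, mul_sub, mul_one, hP, sub_self, sub_zero]
    refine (sub_eq_zero.1 (eq_zero_of_commute_bidiagonal hn hQ
      ((Commute.one_left _).sub_left hc) ?_)).symm
    rw [← he, Matrix.sub_mulVec, h0, h, one_smul, Matrix.one_mulVec, sub_self]

end Bidiagonal

section Cokernel

variable {R : Type u} [CommRing R] {n : ℕ}

/-- A homomorphism of cokernels lifts to a commutative square of matrices. -/
theorem exists_matrix_lift {Φ Φ' : Matrix (Fin n) (Fin n) R}
    (g : matrixCokernel Φ →ₗ[R] matrixCokernel Φ') :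
    ∃ A B : Matrix (Fin n) (Fin n) R, A * Φ = Φ' * B ∧
      ∀ v, g (Submodule.Quotient.mk v) = Submodule.Quotient.mk (A.mulVec v) := by
  obtain ⟨a, ha⟩ := Module.projective_lifting_property (LinearMap.range Φ'.mulVecLin).mkQ
    (g ∘ₗ (LinearMap.range Φ.mulVecLin).mkQ) (Submodule.mkQ_surjective _)
  have ha' : ∀ v, g (Submodule.Quotient.mk v) =
      Submodule.Quotient.mk ((LinearMap.toMatrix' a).mulVec v) := by
    intro v
    rw [LinearMap.toMatrix'_mulVec]
    exact (LinearMap.congr_fun ha v).symm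
  have hb : ∀ j : Fin n, ∃ w, Φ'.mulVec w =
      (LinearMap.toMatrix' a).mulVec (Φ.mulVec (Pi.single j 1)) := by
    intro j
    have h1 := ha' (Φ.mulVec (Pi.single j 1))
    have h2 : (Submodule.Quotient.mk (Φ.mulVec (Pi.single j 1)) : matrixCokernel Φ) = 0 :=
      (Submodule.Quotient.mk_eq_zero _).2 (LinearMap.mem_range_self Φ.mulVecLin _)
    rw [h2, map_zero] at h1
    exact (Submodule.Quotient.mk_eq_zero _).1 h1.symm
  choose b hb using hb
  refine ⟨LinearMap.toMatrix' a, (Matrix.of b).transpose, ?_, ha'⟩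
  refine Matrix.ext_of_mulVec_single fun j => ?_
  rw [← Matrix.mulVec_mulVec, ← Matrix.mulVec_mulVec, ← hb, Matrix.mulVec_single_one]
  rfl

/-- Equivalent matrices have isomorphic cokernels. -/
theorem nonempty_cokernel_equiv {A B P Q : Matrix (Fin n) (Fin n) R} (hP : IsUnit P.det)
    (hQ : IsUnit Q.det) (h : P * A = B * Q) :
    Nonempty (matrixCokernel A ≃ₗ[R] matrixCokernel B) := by
  let e : (Fin n → R) ≃ₗ[R] (Fin n → R) := LinearEquiv.ofLinearMap P.mulVecLin P⁻¹.mulVecLin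
    (by rw [← Matrix.mulVecLin_mul, Matrix.mul_nonsing_inv _ hP, Matrix.mulVecLin_one])
    (by rw [← Matrix.mulVecLin_mul, Matrix.nonsing_inv_mul _ hP, Matrix.mulVecLin_one])
  refine ⟨Submodule.Quotient.equiv _ _ e ?_⟩
  have h1 : LinearMap.range Q.mulVecLin = ⊤ := by
    rw [LinearMap.range_eq_top]
    intro v
    refine ⟨Q⁻¹.mulVec v, ?_⟩
    rw [Matrix.mulVecLin_apply, Matrix.mulVec_mulVec, Matrix.mul_nonsing_inv _ hQ,
      Matrix.one_mulVec]
  change Submodule.map P.mulVecLin _ = _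
  rw [← LinearMap.range_comp, ← Matrix.mulVecLin_mul, h, Matrix.mulVecLin_mul,
    LinearMap.range_comp, h1, Submodule.map_top]

/-- Scaling the diagonal by a unit is undone by multiplying with diagonal matrices of powers. -/
theorem nonempty_cokernel_bidiagonal_equiv {c : R} (hc : IsUnit c) (x z : R) (n : ℕ) :
    Nonempty (matrixCokernel (bidiagonal x z n) ≃ₗ[R]
      matrixCokernel (bidiagonal (c * x) z n)) := by
  refine nonempty_cokernel_equiv (P := Matrix.diagonal fun i => c ^ ((i : ℕ) + 1))
    (Q := Matrix.diagonal fun i => c ^ (i : ℕ)) ?_ ?_ ?_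
  · rw [Matrix.det_diagonal, IsUnit.prod_iff]
    exact fun i _ => hc.pow _
  · rw [Matrix.det_diagonal, IsUnit.prod_iff]
    exact fun i _ => hc.pow _
  · ext i j
    rw [Matrix.diagonal_mul, Matrix.mul_diagonal]
    simp only [bidiagonal, Matrix.of_apply]
    split_ifs with h h'
    · subst h; ring
    · rw [h']; ring
    · simp

theorem IsMinimallyGeneratedBy.congr {M M' : Type u} [AddCommGroup M] [Module R M]
    [AddCommGroup M'] [Module R M'] {n n' : ℕ} (h : IsMinimallyGeneratedBy R M n)
    (h' : IsMinimallyGeneratedBy R M' n') (e : M ≃ₗ[R] M') : n = n' := by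
  have key : ∀ {M M' : Type u} [AddCommGroup M] [Module R M] [AddCommGroup M'] [Module R M'],
      (M ≃ₗ[R] M') → ∀ m, (∃ g : Fin m → M, Submodule.span R (Set.range g) = ⊤) →
      ∃ g : Fin m → M', Submodule.span R (Set.range g) = ⊤ := by
    rintro M M' _ _ _ _ e m ⟨g, hg⟩
    refine ⟨e ∘ g, ?_⟩
    rw [Set.range_comp, ← LinearEquiv.coe_coe, Submodule.span_image, hg, Submodule.map_top,
      LinearEquiv.range]
  exact le_antisymm (h.2 (key e.symm _ h'.1)) (h'.2 (key e _ h.1))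

end Cokernel

/-! ### Cokernels of bidiagonal matrices of linear forms -/

/-- The part of the grading of `R` that is used to compare cokernels of matrices of linear forms:
an augmentation `ε` with nilpotent kernel and a space `V` of elements that is detected by
functionals which read off the component of degree one. -/
structure IsDegreeOnePart {k : Type v} {R : Type u} [Field k] [CommRing R] [Algebra k R]
    (ε : R →ₐ[k] k) (V : Submodule k R) : Prop where
  augmentation_eq_zero : ∀ v ∈ V, ε v = 0
  exists_functional : ∀ φ : Module.Dual k V, ∃ D : R →+ k, ∀ (r : R) (v : V), D (r * v) = ε r * φ v
  isNilpotent_ker : IsNilpotent (RingHom.ker ε)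

theorem Submodule.exists_dual_eq_one_eq_zero {k : Type v} {V : Type u} [Field k] [AddCommGroup V]
    [Module k V] {x z : V} (h : x ∉ Submodule.span k {z}) :
    ∃ φ : Module.Dual k V, φ x = 1 ∧ φ z = 0 := by
  obtain ⟨φ, h1, h2⟩ := Submodule.exists_le_ker_of_notMem h
  refine ⟨(φ x)⁻¹ • φ, by simp [h1], ?_⟩
  have h3 : φ z = 0 := h2 (Submodule.mem_span_singleton_self z)
  simp [h3]

namespace IsDegreeOnePart

variable {k : Type v} {R : Type u} [Field k] [CommRing R] [Algebra k R] {ε : R →ₐ[k] k}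
  {V : Submodule k R} {n : ℕ} {x z x' z' : V}

theorem map_bidiagonal (h : IsDegreeOnePart ε V) (x z : V) (n : ℕ) :
    (bidiagonal (x : R) z n).map ε = 0 := by
  ext i j
  simp only [bidiagonal, Matrix.map_apply, Matrix.of_apply, Matrix.zero_apply]
  split_ifs
  · exact h.augmentation_eq_zero _ x.2
  · exact h.augmentation_eq_zero _ z.2
  · exact map_zero ε

/-- The degree one component of an identity `A Φ = Φ' B` between matrices with linear `Φ`, `Φ'`. -/
theorem map_mul_bidiagonal_eq (h : IsDegreeOnePart ε V) {A B : Matrix (Fin n) (Fin n) R}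
    (hAB : A * bidiagonal (x : R) z n = bidiagonal (x' : R) z' n * B) (φ : Module.Dual k V) :
    A.map ε * bidiagonal (φ x) (φ z) n = bidiagonal (φ x') (φ z') n * B.map ε := by
  obtain ⟨D, hD⟩ := h.exists_functional φ
  have key : ∀ (x z : V) (r : R) (i j : Fin n),
      D (r * bidiagonal (x : R) z n i j) = ε r * bidiagonal (φ x) (φ z) n i j := by
    intro x z r i j
    simp only [bidiagonal, Matrix.of_apply]
    split_ifs
    · exact hD r x
    · exact hD r z
    · simp
  ext i j
  have h1 := congrArg D (congrFun (congrFun hAB i) j)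
  rw [Matrix.mul_apply, Matrix.mul_apply, map_sum, map_sum] at h1
  rw [Matrix.mul_apply, Matrix.mul_apply]
  simp only [Matrix.map_apply]
  convert h1 using 1
  · exact Finset.sum_congr rfl fun l _ => (key x z _ _ _).symm
  · refine Finset.sum_congr rfl fun l _ => ?_
    rw [mul_comm (bidiagonal (x' : R) z' n i l), key, mul_comm]

/-- Reduction of the cokernel of a matrix with entries in `V` modulo the kernel of `ε`. -/
def reduction (h : IsDegreeOnePart ε V) (x z : V) (n : ℕ) :
    matrixCokernel (bidiagonal (x : R) z n) →ₛₗ[(ε : R →+* k)] (Fin n → k) :=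
  Submodule.liftQ _
    { toFun := fun v i => ε (v i)
      map_add' := fun v w => by ext i; simp
      map_smul' := fun r v => by ext i; simp } <| by
    rintro _ ⟨v, rfl⟩
    rw [LinearMap.mem_ker]
    ext i
    have h1 := RingHom.map_mulVec (ε : R →+* k) (bidiagonal (x : R) z n) v i
    change _ = ((bidiagonal (x : R) z n).map ε).mulVec _ i at h1
    rw [h.map_bidiagonal, Matrix.zero_mulVec] at h1
    exact h1

theorem reduction_mk (h : IsDegreeOnePart ε V) (x z : V) (n : ℕ) (v : Fin n → R) :
    h.reduction x z n (Submodule.Quotient.mk v) = fun i => ε (v i) := rfl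

theorem reduction_surjective (h : IsDegreeOnePart ε V) (x z : V) (n : ℕ) :
    Function.Surjective (h.reduction x z n) := by
  intro w
  refine ⟨Submodule.Quotient.mk fun i => algebraMap k R (w i), ?_⟩
  rw [reduction_mk]
  ext i
  simp

theorem reduction_mk_mulVec (h : IsDegreeOnePart ε V) (x z : V) (n : ℕ)
    (A : Matrix (Fin n) (Fin n) R) (v : Fin n → R) :
    h.reduction x z n (Submodule.Quotient.mk (A.mulVec v)) = (A.map ε).mulVec fun i => ε (v i) := by
  rw [reduction_mk]
  ext i
  exact RingHom.map_mulVec (ε : R →+* k) A v i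

/-- The matrix of a lift of an endomorphism is determined modulo the kernel of `ε`. -/
theorem map_eq_of_forall_mk_eq (h : IsDegreeOnePart ε V) {A B : Matrix (Fin n) (Fin n) R}
    (hAB : ∀ v, (Submodule.Quotient.mk (A.mulVec v) : matrixCokernel (bidiagonal (x : R) z n)) =
      Submodule.Quotient.mk (B.mulVec v)) : A.map ε = B.map ε := by
  refine Matrix.ext_of_mulVec_single fun j => ?_
  have h1 := congrArg (h.reduction x z n) (hAB (Pi.single j 1))
  rw [reduction_mk_mulVec, reduction_mk_mulVec] at h1
  have h2 : (fun i => ε ((Pi.single j 1 : Fin n → R) i)) = Pi.single j 1 := by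
    ext i
    by_cases hij : i = j
    · subst hij; simp
    · simp [hij]
  rwa [h2] at h1

theorem isMinimallyGeneratedBy (h : IsDegreeOnePart ε V) (x z : V) (n : ℕ) :
    IsMinimallyGeneratedBy R (matrixCokernel (bidiagonal (x : R) z n)) n := by
  constructor
  · refine ⟨fun i => Submodule.Quotient.mk (Pi.basisFun R (Fin n) i), ?_⟩
    have h1 := Submodule.map_span (LinearMap.range (bidiagonal (x : R) z n).mulVecLin).mkQ
      (Set.range (Pi.basisFun R (Fin n)))
    rw [(Pi.basisFun R (Fin n)).span_eq, Submodule.map_top, Submodule.range_mkQ,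
      ← Set.range_comp] at h1
    exact h1.symm
  · rintro m ⟨g, hg⟩
    have : RingHomSurjective (ε : R →+* k) := ⟨fun c => ⟨algebraMap k R c, by simp⟩⟩
    have h1 := Submodule.map_span (h.reduction x z n) (Set.range g)
    rw [hg, Submodule.map_top, LinearMap.range_eq_top.2 (h.reduction_surjective x z n),
      ← Set.range_comp] at h1
    have h2 := finrank_range_le_card (R := k) (h.reduction x z n ∘ g)
    rw [Set.finrank, ← h1, finrank_top] at h2
    simpa using h2

/-- An idempotent endomorphism that vanishes modulo the kernel of `ε` vanishes. -/
theorem eq_zero_of_map_eq_zero (h : IsDegreeOnePart ε V) {Φ : Matrix (Fin n) (Fin n) R}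
    {g : matrixCokernel Φ →ₗ[R] matrixCokernel Φ} (hg : ∀ m, g (g m) = g m)
    {A : Matrix (Fin n) (Fin n) R}
    (hA : ∀ v, g (Submodule.Quotient.mk v) = Submodule.Quotient.mk (A.mulVec v))
    (h0 : A.map ε = 0) : g = 0 := by
  obtain ⟨m, hm⟩ := h.isNilpotent_ker
  have hpow : ∀ l i j, (A ^ l) i j ∈ RingHom.ker ε ^ l := by
    intro l
    induction l with
    | zero => intro i j; simp
    | succ l ih =>
      intro i j
      rw [pow_succ A, Matrix.mul_apply, pow_succ]
      exact sum_mem fun t _ => Ideal.mul_mem_mul (ih i t) (congrFun (congrFun h0 t) j)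
  have hAm : A ^ m = 0 := by
    ext i j
    have := hpow m i j
    rwa [hm] at this
  have hgl : ∀ l v, g (Submodule.Quotient.mk v) = g (Submodule.Quotient.mk ((A ^ l).mulVec v)) := by
    intro l
    induction l with
    | zero => intro v; simp
    | succ l ih =>
      intro v
      rw [pow_succ, ← Matrix.mulVec_mulVec, ← ih, ← hA, hg]
  refine LinearMap.ext fun w => ?_
  obtain ⟨v, rfl⟩ := Submodule.Quotient.mk_surjective _ w
  rw [hgl m, hAm, Matrix.zero_mulVec]
  simp

/-- The constant part of a lift of an idempotent endomorphism commutes with the Jordan block, so the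
idempotent is `0` or `1`. -/
theorem isIndecomposableModule (h : IsDegreeOnePart ε V) (hn : 0 < n)
    (hxz : x ∉ Submodule.span k {z}) (hzx : z ∉ Submodule.span k {x}) :
    IsIndecomposableModule R (matrixCokernel (bidiagonal (x : R) z n)) := by
  have : Nonempty (Fin n) := ⟨⟨0, hn⟩⟩
  refine ⟨(h.reduction_surjective x z n).nontrivial, fun N N' hN => ?_⟩
  set g := N.projection N' hN with hg
  have hgg : ∀ m, g (g m) = g m := fun m =>
    N.projection_apply_of_mem_left hN (N.projection_apply_mem hN m)
  obtain ⟨A, B, hAB, hA⟩ := exists_matrix_lift g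
  obtain ⟨φ, hφx, hφz⟩ := Submodule.exists_dual_eq_one_eq_zero hxz
  obtain ⟨ψ, hψz, hψx⟩ := Submodule.exists_dual_eq_one_eq_zero hzx
  have h1 := h.map_mul_bidiagonal_eq hAB φ
  have h2 := h.map_mul_bidiagonal_eq hAB ψ
  -- The coefficient of `x` gives `A₀ = B₀`, and that of `z` gives `A₀ N = N B₀`.
  rw [hφx, hφz, bidiagonal_eq_smul_add_smul, one_smul, zero_smul, add_zero, mul_one, one_mul] at h1
  rw [hψx, hψz, ← h1] at h2
  have hidem : A.map ε * A.map ε = A.map ε := by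
    have h3 : (A * A).map ε = A.map ε := h.map_eq_of_forall_mk_eq (x := x) (z := z) fun v => by
      rw [← Matrix.mulVec_mulVec, ← hA, ← hA, hgg]
    exact (Matrix.map_mul (L := A) (M := A) (f := ε)).symm.trans h3
  rcases eq_zero_or_eq_one_of_commute_bidiagonal hn hidem h2 with h3 | h3
  · left
    have h4 : g = 0 := h.eq_zero_of_map_eq_zero hgg hA h3
    rw [← N.range_projection hN, ← hg, h4, LinearMap.range_zero]
  · right
    have h4 : LinearMap.id - g = 0 := by
      refine h.eq_zero_of_map_eq_zero (A := 1 - A) (fun m => by simp [hgg]) (fun v => ?_) ?_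
      · rw [LinearMap.sub_apply, hA, LinearMap.id_apply, Matrix.sub_mulVec, Matrix.one_mulVec]
        rfl
      · ext i j
        have h5 := congrFun (congrFun h3 i) j
        rw [Matrix.map_apply] at h5
        rw [Matrix.map_apply, Matrix.sub_apply, map_sub, h5, Matrix.one_apply, Matrix.one_apply]
        split_ifs <;> simp
    rw [← N.ker_projection hN, ← hg, ← sub_eq_zero.1 h4, LinearMap.ker_id]

/-- The isomorphism class of the cokernel determines the line spanned by `x`. -/
theorem mem_span_of_equiv (h : IsDegreeOnePart ε V) (hn : 0 < n)
    (hxz : x ∉ Submodule.span k {z})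
    (e : matrixCokernel (bidiagonal (x : R) z n) ≃ₗ[R] matrixCokernel (bidiagonal (x' : R) z n)) :
    x' ∈ Submodule.span k {x} := by
  by_contra hx'
  obtain ⟨A, B, hAB, hA⟩ := exists_matrix_lift e.toLinearMap
  obtain ⟨C, -, -, hC⟩ := exists_matrix_lift e.symm.toLinearMap
  obtain ⟨φ, hφx, hφz⟩ := Submodule.exists_dual_eq_one_eq_zero hxz
  obtain ⟨ψ, hψx', hψx⟩ := Submodule.exists_dual_eq_one_eq_zero hx'
  have h1 := h.map_mul_bidiagonal_eq hAB φ
  have h2 := h.map_mul_bidiagonal_eq hAB ψ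
  -- The functional `φ` gives `A₀ = φ(x') B₀`, and `ψ` gives `ψ(z) A₀ N = (1 + ψ(z) N) B₀`.
  rw [hφx, hφz, bidiagonal_eq_smul_add_smul, bidiagonal_eq_smul_add_smul (φ x'), one_smul,
    zero_smul, add_zero, mul_one, add_zero, smul_mul_assoc, one_mul] at h1
  rw [hψx', hψx, bidiagonal_eq_smul_add_smul, bidiagonal_eq_smul_add_smul (1 : k), one_smul,
    zero_smul, zero_add] at h2
  set e₀ : Fin n → k := Pi.single ⟨0, hn⟩ 1 with he₀
  have h3 : (C * A).map ε = (1 : Matrix (Fin n) (Fin n) R).map ε :=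
    h.map_eq_of_forall_mk_eq (x := x) (z := z) fun v => by
      have h4 := hC (A.mulVec v)
      rw [← hA] at h4
      rw [← Matrix.mulVec_mulVec, ← h4, Matrix.one_mulVec]
      exact e.symm_apply_apply _
  have h3' : C.map ε * A.map ε = 1 := by
    have h4 : (C * A).map ε = C.map ε * A.map ε := Matrix.map_mul (f := ε)
    rw [← h4, h3]
    exact Matrix.map_one ε (map_zero ε) (map_one ε)
  -- Applying the second relation to the vector killed by the Jordan block, the unipotent matrix
  -- on the right forces the image of that vector to vanish.
  have h5 : (B.map ε).mulVec e₀ = 0 := by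
    have h6 := congrArg (fun M => M.mulVec e₀) h2
    rw [← Matrix.mulVec_mulVec, Matrix.smul_mulVec, he₀, bidiagonal_zero_one_mulVec_single_zero,
      smul_zero, Matrix.mulVec_zero, ← he₀, ← Matrix.mulVec_mulVec] at h6
    have hnil : IsNilpotent (ψ z • bidiagonal (0 : k) 1 n) :=
      ⟨n, by rw [smul_pow, bidiagonal_zero_one_pow, smul_zero]⟩
    obtain ⟨U, hU⟩ := hnil.isUnit_one_add
    rw [← hU] at h6
    have h7 := congrArg (fun v => (U⁻¹.val).mulVec v) h6
    simpa using h7.symm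
  have h6 : (A.map ε).mulVec e₀ = 0 := by
    rw [h1, Matrix.smul_mulVec, h5, smul_zero]
  have h7 : e₀ = 0 := by
    rw [← Matrix.one_mulVec e₀, ← h3', ← Matrix.mulVec_mulVec, h6, Matrix.mulVec_zero]
  simpa [he₀] using congrFun h7 ⟨0, hn⟩

end IsDegreeOnePart

/-! ### Open subsets of projective space -/

section Zariski

variable {k : Type v} {V : Type u} [Field k] [AddCommGroup V] [Module k V]

theorem Projectivization.mk_eq_mk_iff_mem_span {v w : V} (hv : v ≠ 0) (hw : w ≠ 0) :
    Projectivization.mk k v hv = Projectivization.mk k w hw ↔ v ∈ Submodule.span k {w} := by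
  rw [Projectivization.mk_eq_mk_iff', Submodule.mem_span_singleton]

theorem isOpen_zariskiTopology_ne (z : V) (hz : z ≠ 0) :
    IsOpen[zariskiTopology k V] {p : ℙ k V | p ≠ Projectivization.mk k z hz} := by
  let _ : TopologicalSpace (ℙ k V) := zariskiTopology k V
  have h : {p : ℙ k V | p ≠ Projectivization.mk k z hz} =
      ⋃ φ ∈ {φ : Module.Dual k V | φ z = 0}, {p : ℙ k V | φ p.rep ≠ 0} := by
    ext p
    simp only [Set.mem_ofPred_eq, Set.mem_iUnion, exists_prop]
    constructor
    · intro hp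
      have hp' : p.rep ∉ Submodule.span k {z} := by
        rwa [← Projectivization.mk_eq_mk_iff_mem_span p.rep_nonzero hz, p.mk_rep]
      obtain ⟨φ, h1, h2⟩ := Submodule.exists_dual_eq_one_eq_zero hp'
      exact ⟨φ, h2, by rw [h1]; exact one_ne_zero⟩
    · rintro ⟨φ, h1, h2⟩ rfl
      obtain ⟨a, ha⟩ := Projectivization.exists_smul_eq_mk_rep k z hz
      rw [← ha, Units.smul_def, map_smul, h1, smul_zero] at h2
      exact h2 rfl
  rw [h]
  refine isOpen_biUnion fun φ _ => TopologicalSpace.isOpen_generateFrom_of_mem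
    ⟨1, MvPolynomial.X φ, MvPolynomial.isHomogeneous_X k φ, ?_⟩
  simp

/-- Invertibility is an open condition on the members of a linear family of endomorphisms: the
determinant is a homogeneous polynomial in the parameter. -/
theorem isOpen_zariskiTopology_isUnit {W : Type*} [AddCommGroup W] [Module k W]
    [Module.Finite k W] (B : V →ₗ[k] Module.End k W) :
    IsOpen[zariskiTopology k V] {p : ℙ k V | IsUnit (B p.rep)} := by
  let b := Module.finBasis k W
  let φ : Fin (Module.finrank k W) → Fin (Module.finrank k W) → Module.Dual k V := fun i j =>
    b.coord i ∘ₗ LinearMap.applyₗ (b j) ∘ₗ B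
  refine TopologicalSpace.isOpen_generateFrom_of_mem ⟨Fintype.card (Fin (Module.finrank k W)),
    (Matrix.of fun i j => MvPolynomial.X (φ i j)).det, ?_, ?_⟩
  · rw [Matrix.det_apply]
    refine MvPolynomial.IsHomogeneous.sum _ _ _ fun σ _ => ?_
    rw [← Finset.card_univ, Finset.card_eq_sum_ones]
    have h1 : (∏ i, (Matrix.of fun i j => (MvPolynomial.X (φ i j) :
        MvPolynomial (Module.Dual k V) k)) (σ i) i).IsHomogeneous (∑ _i, 1) :=
      MvPolynomial.IsHomogeneous.prod _ _ _ fun i _ => MvPolynomial.isHomogeneous_X k _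
    rcases Int.units_eq_one_or (Equiv.Perm.sign σ) with h | h
    · rw [h, one_smul]; exact h1
    · rw [h, Units.neg_smul, one_smul]; exact h1.neg
  · ext p
    rw [Set.mem_ofPred_eq, Set.mem_ofPred_eq, LinearMap.isUnit_iff_isUnit_det, isUnit_iff_ne_zero,
      ← LinearMap.det_toMatrix b, RingHom.map_det]
    have : LinearMap.toMatrix b b (B p.rep) = (MvPolynomial.eval fun φ : Module.Dual k V =>
        φ p.rep).mapMatrix (Matrix.of fun i j => MvPolynomial.X (φ i j)) := by
      ext i j
      rw [LinearMap.toMatrix_apply]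
      simp [φ]
    rw [this]

/-- A linear family of endomorphisms with an invertible member `B x₀` has an invertible member
off any given line. -/
theorem exists_isUnit_notMem_span [Infinite k] {W : Type*} [AddCommGroup W] [Module k W]
    [Module.Finite k W] (B : V →ₗ[k] Module.End k W) {x₀ : V} (h₀ : B x₀ = 1)
    (hV : 2 ≤ Module.finrank k V) {z : V} (hz : z ≠ 0) :
    ∃ x, IsUnit (B x) ∧ x ∉ Submodule.span k {z} := by
  by_cases hx₀ : x₀ ∈ Submodule.span k {z}
  · obtain ⟨y, hy⟩ : ∃ y, y ∉ Submodule.span k {z} := by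
      by_contra! h
      have h1 : Submodule.span k {z} = ⊤ := eq_top_iff.2 fun y _ => h y
      have h2 := finrank_span_singleton (K := k) hz
      rw [h1, finrank_top] at h2
      omega
    -- `B (y - μ x₀) = B y - μ` is invertible unless `μ` is one of the finitely many eigenvalues.
    obtain ⟨μ, hμ⟩ := ((B y).finite_hasEigenvalue).infinite_compl.nonempty
    refine ⟨y - μ • x₀, ?_, fun h => hy ?_⟩
    · rw [map_sub, map_smul, h₀, LinearMap.isUnit_iff_ker_eq_bot]
      rw [Set.mem_compl_iff, Set.mem_ofPred_eq, Module.End.HasEigenvalue,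
        Module.End.HasUnifEigenvalue, not_not, Module.End.genEigenspace_one] at hμ
      exact hμ
    · have := add_mem h (Submodule.smul_mem _ μ hx₀)
      rwa [sub_add_cancel] at this
  · exact ⟨x₀, by rw [h₀]; exact isUnit_one, hx₀⟩

end Zariski

/-! ### Homogeneous graded rings of minimal multiplicity -/

section Graded

open DirectSum

variable {k : Type v} {S : Type u} [Field k] [CommRing S] [Algebra k S]
  {𝒮 : ℕ → Submodule k S} [GradedAlgebra 𝒮]

theorem coe_decompose_one_mul (s t : S) : (decompose 𝒮 (s * t) 1 : S) =
    decompose 𝒮 s 0 * decompose 𝒮 t 1 + decompose 𝒮 s 1 * decompose 𝒮 t 0 := by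
  rw [decompose_mul, coe_mul_apply_eq_sum_antidiagonal, Finset.Nat.sum_antidiagonal_eq_sum_range_succ
    (fun i j => (decompose 𝒮 s i : S) * decompose 𝒮 t j)]
  simp [Finset.sum_range_succ]

theorem coe_decompose_two_mul (s t : S) : (decompose 𝒮 (s * t) 2 : S) =
    decompose 𝒮 s 0 * decompose 𝒮 t 2 + decompose 𝒮 s 1 * decompose 𝒮 t 1 +
      decompose 𝒮 s 2 * decompose 𝒮 t 0 := by
  rw [decompose_mul, coe_mul_apply_eq_sum_antidiagonal, Finset.Nat.sum_antidiagonal_eq_sum_range_succ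
    (fun i j => (decompose 𝒮 s i : S) * decompose 𝒮 t j)]
  simp [Finset.sum_range_succ]

theorem mem_irrelevant_iff_decompose_eq_zero {s : S} :
    s ∈ (HomogeneousIdeal.irrelevant 𝒮).toIdeal ↔ (decompose 𝒮 s 0 : S) = 0 := Iff.rfl

namespace IsHomogeneousGradedRing

/-- The projection of a homogeneous graded ring to its component `k` of degree zero. -/
noncomputable def augmentation (hS : IsHomogeneousGradedRing 𝒮) : S →ₐ[k] k :=
  have := hS.nontrivial
  (AlgEquiv.ofInjectiveField (Algebra.ofId k S)).symm.toAlgHom.comp <|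
    AlgHom.codRestrict
      { GradedRing.projZeroRingHom 𝒮 with
        commutes' := fun c => decompose_of_mem_same 𝒮 (SetLike.algebraMap_mem_graded 𝒮 c) }
      (Algebra.ofId k S).range fun s => by
        have h : (decompose 𝒮 s 0 : S) ∈ LinearMap.range (Algebra.linearMap k S) :=
          hS.degree_zero ▸ (decompose 𝒮 s 0).2
        exact h

theorem algebraMap_augmentation (hS : IsHomogeneousGradedRing 𝒮) (s : S) :
    algebraMap k S (hS.augmentation s) = decompose 𝒮 s 0 := by
  have := hS.nontrivial
  exact congrArg Subtype.val
    ((AlgEquiv.ofInjectiveField (Algebra.ofId k S)).apply_symm_apply _)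

theorem augmentation_eq_zero_iff (hS : IsHomogeneousGradedRing 𝒮) {s : S} :
    hS.augmentation s = 0 ↔ s ∈ (HomogeneousIdeal.irrelevant 𝒮).toIdeal := by
  have := hS.nontrivial
  rw [mem_irrelevant_iff_decompose_eq_zero, ← hS.algebraMap_augmentation,
    map_eq_zero_iff _ (FaithfulSMul.algebraMap_injective k S)]

theorem irrelevant_eq_span (hS : IsHomogeneousGradedRing 𝒮) :
    (HomogeneousIdeal.irrelevant 𝒮).toIdeal = Ideal.span (𝒮 1 : Set S) := by
  have hle : Ideal.span (𝒮 1 : Set S) ≤ (HomogeneousIdeal.irrelevant 𝒮).toIdeal :=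
    Ideal.span_le.2 fun s hs => HomogeneousIdeal.mem_irrelevant_of_mem 𝒮 one_pos hs
  refine le_antisymm (fun s hs => ?_) hle
  have key : ∀ s : S, s - algebraMap k S (hS.augmentation s) ∈ Ideal.span (𝒮 1 : Set S) := by
    intro s
    have hs : s ∈ Algebra.adjoin k (𝒮 1 : Set S) := by
      rw [hS.adjoin_degree_one]; exact Algebra.mem_top
    induction hs using Algebra.adjoin_induction with
    | mem x hx =>
      have hx' := Ideal.subset_span (α := S) hx
      rw [hS.augmentation_eq_zero_iff.2 (hle hx'), map_zero, sub_zero]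
      exact hx'
    | algebraMap c => simp
    | add x y _ _ hx hy =>
      rw [map_add, map_add, add_sub_add_comm]
      exact add_mem hx hy
    | mul x y _ _ hx hy =>
      have : x * y - algebraMap k S (hS.augmentation (x * y)) =
          (x - algebraMap k S (hS.augmentation x)) * y +
          algebraMap k S (hS.augmentation x) * (y - algebraMap k S (hS.augmentation y)) := by
        rw [map_mul, map_mul]; ring
      rw [this]
      exact add_mem (Ideal.mul_mem_right _ _ hx) (Ideal.mul_mem_left _ _ hy)
  have h := key s
  rwa [hS.augmentation_eq_zero_iff.2 hs, map_zero, sub_zero] at h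

/-- The component of degree two lies in the square of the irrelevant ideal, as the algebra is generated
in degree one. -/
theorem mem_irrelevant_sq (hS : IsHomogeneousGradedRing 𝒮) {u : S} (hu : u ∈ 𝒮 2) :
    u ∈ (HomogeneousIdeal.irrelevant 𝒮).toIdeal ^ 2 := by
  have key : ∀ s ∈ Ideal.span (𝒮 1 : Set S),
      (decompose 𝒮 s 2 : S) ∈ (HomogeneousIdeal.irrelevant 𝒮).toIdeal ^ 2 := by
    have hmem : ∀ s : S, (decompose 𝒮 s 1 : S) ∈ (HomogeneousIdeal.irrelevant 𝒮).toIdeal :=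
      fun s => HomogeneousIdeal.mem_irrelevant_of_mem 𝒮 one_pos (decompose 𝒮 s 1).2
    intro s hs
    induction hs using Submodule.span_induction with
    | mem x hx => simp [decompose_of_mem_ne 𝒮 hx (show 1 ≠ 2 by decide)]
    | zero => simp
    | add x y _ _ hx hy =>
      rw [decompose_add, DirectSum.add_apply, Submodule.coe_add]
      exact add_mem hx hy
    | smul a x hx' hx =>
      have hx0 : (decompose 𝒮 x 0 : S) = 0 :=
        mem_irrelevant_iff_decompose_eq_zero.1 (hS.irrelevant_eq_span ▸ hx')
      rw [smul_eq_mul, coe_decompose_two_mul, hx0, mul_zero, add_zero]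
      refine add_mem (Ideal.mul_mem_left _ _ hx) ?_
      rw [pow_two]
      exact Ideal.mul_mem_mul (hmem a) (hmem x)
  have h := key u (hS.irrelevant_eq_span ▸ HomogeneousIdeal.mem_irrelevant_of_mem 𝒮 two_pos hu)
  rwa [decompose_of_mem_same 𝒮 hu] at h

end IsHomogeneousGradedRing

theorem HasMinimalMultiplicity.exists_sq_le {A : Type u} [CommRing A] [IsLocalRing A]
    (hdim : ringKrullDim A ≤ 1) (hA : HasMinimalMultiplicity A) :
    ∃ a ∈ IsLocalRing.maximalIdeal A,
      IsLocalRing.maximalIdeal A ^ 2 ≤ Ideal.span {a} * IsLocalRing.maximalIdeal A := by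
  obtain ⟨xs, ⟨hlen, hrad⟩, hxs⟩ := hA
  rw [hlen] at hdim
  have hlen' : xs.length ≤ 1 := by exact_mod_cast hdim
  -- In dimension zero the empty system of parameters generates the zero ideal, so `a = 0` serves.
  rcases xs with _ | ⟨a, _ | ⟨b, xs⟩⟩
  · exact ⟨0, zero_mem _, by simp [← hxs]⟩
  · rw [Ideal.ofList_singleton] at hrad hxs
    refine ⟨a, ?_, hxs.ge⟩
    rw [← hrad]
    exact Ideal.le_radical (Ideal.mem_span_singleton_self a)
  · simp at hlen'

/-- Minimal multiplicity in dimension one gives a linear form whose multiples exhaust the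
component of degree two: clear denominators in `a 𝔪 = 𝔪²` and compare components of degree two. -/
theorem IsHomogeneousGradedRing.exists_degree_two_le (hS : IsHomogeneousGradedRing 𝒮)
    (hdim : ringKrullDim S ≤ 1) {n : Ideal S} [n.IsPrime]
    (hn : (HomogeneousIdeal.irrelevant 𝒮).toIdeal = n)
    (hmult : HasMinimalMultiplicity (Localization.AtPrime n)) :
    ∃ y ∈ 𝒮 1, ∀ u ∈ 𝒮 2, ∃ t ∈ 𝒮 1, u = y * t := by
  obtain ⟨a, ha, hsq⟩ := hmult.exists_sq_le <| by
    rw [IsLocalization.AtPrime.ringKrullDim_eq_height n]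
    exact Ideal.height_le_ringKrullDim_of_isPrime.trans hdim
  obtain ⟨s, q, rfl⟩ := IsLocalization.exists_mk'_eq n.primeCompl a
  have hs : s ∈ n := (IsLocalization.AtPrime.mk'_mem_maximal_iff _ n s q).1 ha
  refine ⟨decompose 𝒮 s 1, (decompose 𝒮 s 1).2, fun u hu => ?_⟩
  have hu1 : algebraMap S (Localization.AtPrime n) u ∈ IsLocalRing.maximalIdeal (Localization.AtPrime n) ^ 2 := by
    rw [← Localization.AtPrime.map_eq_maximalIdeal, ← Ideal.map_pow]
    exact Ideal.mem_map_of_mem _ (hn ▸ hS.mem_irrelevant_sq hu)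
  obtain ⟨b, hb, hab⟩ := Ideal.mem_span_singleton_mul.1 (hsq hu1)
  obtain ⟨t, q', rfl⟩ := IsLocalization.exists_mk'_eq n.primeCompl b
  have ht : t ∈ n := (IsLocalization.AtPrime.mk'_mem_maximal_iff _ n t q').1 hb
  rw [← IsLocalization.mk'_mul, IsLocalization.mk'_eq_iff_eq_mul, ← map_mul,
    IsLocalization.eq_iff_exists n.primeCompl] at hab
  obtain ⟨c, hc⟩ := hab
  obtain ⟨T, hT, heq⟩ : ∃ T ∉ n, T * u = s * (c * t) :=
    ⟨(q * q' : n.primeCompl) * c, (q * q' * c).2, by linear_combination -hc⟩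
  have hct : (c : S) * t ∈ n := Ideal.mul_mem_left n c ht
  have hs0 : (decompose 𝒮 s 0 : S) = 0 :=
    mem_irrelevant_iff_decompose_eq_zero.1 (by rw [hn]; exact hs)
  have hct0 : (decompose 𝒮 (c * t) 0 : S) = 0 :=
    mem_irrelevant_iff_decompose_eq_zero.1 (by rw [hn]; exact hct)
  have h2 := congrArg (fun r => (decompose 𝒮 r 2 : S)) heq
  simp only at h2
  rw [coe_decompose_two_mul, coe_decompose_two_mul, hs0, hct0,
    decompose_of_mem_same 𝒮 hu, decompose_of_mem_ne 𝒮 hu (show 2 ≠ 0 by decide),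
    decompose_of_mem_ne 𝒮 hu (show 2 ≠ 1 by decide), ← hS.algebraMap_augmentation] at h2
  simp only [mul_zero, zero_mul, add_zero, zero_add] at h2
  have hT0 : hS.augmentation T ≠ 0 := fun h => hT (hn ▸ hS.augmentation_eq_zero_iff.1 h)
  refine ⟨(hS.augmentation T)⁻¹ • (decompose 𝒮 (c * t) 1 : S),
    Submodule.smul_mem _ _ (decompose 𝒮 (c * t) 1).2, ?_⟩
  rw [mul_smul_comm, ← h2, ← Algebra.smul_def, smul_smul, inv_mul_cancel₀ hT0, one_smul]

end Graded

/-! ### Matrix factorizations of a quadratic form -/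

section MatrixFactorization

/-- If `f = x w₀` and `z w_i = x w_{i+1}`, then `x + z N` is a factor of `f` in a matrix
factorization, for `N` the nilpotent Jordan block: its partner is the alternating sum of
the `w_i N ^ i`, which is `f (x + z N)⁻¹`. -/
theorem exists_matrixFactorization_bidiagonal {S : Type u} [CommRing S] {f x z : S} {w : ℕ → S}
    (h₀ : f = x * w 0) (hw : ∀ i, z * w i = x * w (i + 1)) (n : ℕ) :
    ∃ B : Matrix (Fin n) (Fin n) S, bidiagonal x z n * B = Matrix.scalar _ f ∧
      B * bidiagonal x z n = Matrix.scalar _ f := by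
  set N : Matrix (Fin n) (Fin n) S := bidiagonal 0 1 n with hN
  have hcomm : Commute (bidiagonal x z n) (∑ i ∈ Finset.range n, ((-1) ^ i * w i) • N ^ i) := by
    rw [bidiagonal_eq_smul_add_smul, ← hN]
    refine Commute.sum_right _ _ _ fun i _ => Commute.smul_right ?_ _
    exact ((Commute.one_left _).smul_left x).add_left (((Commute.refl N).pow_right i).smul_left z)
  have hprod : bidiagonal x z n * (∑ i ∈ Finset.range n, ((-1) ^ i * w i) • N ^ i) =
      Matrix.scalar _ f := by
    have hterm : ∀ i, bidiagonal x z n * (((-1) ^ i * w i) • N ^ i) =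
        ((-1) ^ i * (x * w i)) • N ^ i - ((-1) ^ (i + 1) * (x * w (i + 1))) • N ^ (i + 1) := by
      intro i
      rw [bidiagonal_eq_smul_add_smul, ← hN, mul_smul_comm, add_mul, smul_mul_assoc, one_mul,
        smul_mul_assoc, ← pow_succ', smul_add, smul_smul, smul_smul, ← hw, sub_eq_add_neg,
        ← neg_smul]
      congr 2 <;> ring
    rw [Finset.mul_sum, Finset.sum_congr rfl fun i _ => hterm i,
      Finset.sum_range_sub' (fun i => ((-1) ^ i * (x * w i)) • N ^ i), hN, bidiagonal_zero_one_pow,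
      smul_zero, sub_zero, pow_zero, one_mul, pow_zero, ← h₀, Matrix.scalar_apply,
      Matrix.smul_one_eq_diagonal]
  exact ⟨_, hprod, hcomm.eq ▸ hprod⟩

end MatrixFactorization

section Graded

open DirectSum

variable {k : Type v} {S : Type u} [Field k] [CommRing S] [Algebra k S]
  {𝒮 : ℕ → Submodule k S} [GradedAlgebra 𝒮] {f : S}

theorem map_bidiagonal {R R' : Type*} [CommRing R] [CommRing R'] (g : R →+* R') (x z : R) (n : ℕ) :
    (bidiagonal x z n).map g = bidiagonal (g x) (g z) n := by
  ext i j
  simp only [bidiagonal, Matrix.map_apply, Matrix.of_apply]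
  split_ifs <;> simp

/-- Multiplication of elements of degree one. -/
def degreeOneMul (𝒮 : ℕ → Submodule k S) [GradedAlgebra 𝒮] : 𝒮 1 →ₗ[k] 𝒮 1 →ₗ[k] 𝒮 2 :=
  LinearMap.mk₂ k (fun s t => ⟨s * t, SetLike.GradedMul.mul_mem (i := 1) (j := 1) s.2 t.2⟩)
    (fun _ _ _ => Subtype.ext (add_mul _ _ _)) (fun _ _ _ => Subtype.ext (smul_mul_assoc _ _ _))
    (fun _ _ _ => Subtype.ext (mul_add _ _ _)) (fun _ _ _ => Subtype.ext (mul_smul_comm _ _ _))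

/-- The forms `w_i` of the matrix factorization are found by repeatedly dividing by `y`. -/
theorem hasGDimZero_cokernel_bidiagonal (hf : f ∈ 𝒮 2) (hf' : f ∈ nonZeroDivisors S) {y : 𝒮 1}
    (hy : Function.Surjective (degreeOneMul 𝒮 y)) (z : 𝒮 1) (n : ℕ) :
    HasGDimZero (S ⧸ Ideal.span {f}) (matrixCokernel (bidiagonal
      (Ideal.Quotient.mk (Ideal.span {f}) (y : S)) (Ideal.Quotient.mk (Ideal.span {f}) z) n)) := by
  choose d hd using hy
  let w : ℕ → 𝒮 1 := fun i =>
    Nat.rec (motive := fun _ => 𝒮 1) (d ⟨f, hf⟩) (fun _ t => d (degreeOneMul 𝒮 z t)) i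
  have h₀ : f = y * w 0 := (congrArg Subtype.val (hd ⟨f, hf⟩)).symm
  have hw : ∀ i, (z : S) * w i = y * w (i + 1) := fun i =>
    (congrArg Subtype.val (hd (degreeOneMul 𝒮 z (w i)))).symm
  obtain ⟨B, h1, h2⟩ :=
    exists_matrixFactorization_bidiagonal (w := fun i : ℕ => (w i : S)) h₀ hw n
  rw [← map_bidiagonal]
  exact (isExactMatrixPair_of_matrixFactorization hf' h1 h2).hasGDimZero

theorem degreeOneMul_bijective (hf : f ∈ 𝒮 2) (hf' : f ∈ nonZeroDivisors S) {y : 𝒮 1}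
    (hy : Function.Surjective (degreeOneMul 𝒮 y)) : Function.Bijective (degreeOneMul 𝒮 y) := by
  refine ⟨?_, hy⟩
  obtain ⟨w, hw⟩ := hy ⟨f, hf⟩
  have hw' : (y : S) * w = f := congrArg Subtype.val hw
  rw [← LinearMap.ker_eq_bot, LinearMap.ker_eq_bot']
  intro t ht
  have ht' : (y : S) * t = 0 := congrArg Subtype.val ht
  refine Subtype.ext (hf'.1 _ ?_)
  rw [← hw', mul_right_comm, ht', zero_mul]

namespace IsHomogeneousGradedRing

/-- Every product of three linear forms is a multiple of `f`: if `y` is a linear form with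
`y S₁ = S₂`, then the product has the form `y² e`, while `f = y w` with `w S₁ = S₂` as well. -/
theorem irrelevant_pow_three_le (hS : IsHomogeneousGradedRing 𝒮) (hf : f ∈ 𝒮 2)
    (hf' : f ∈ nonZeroDivisors S) {y : 𝒮 1} (hy : Function.Surjective (degreeOneMul 𝒮 y)) :
    (HomogeneousIdeal.irrelevant 𝒮).toIdeal ^ 3 ≤ Ideal.span {f} := by
  have := hS.finite_degree_one
  obtain ⟨w, hw⟩ := hy ⟨f, hf⟩
  have hw' : (y : S) * w = f := congrArg Subtype.val hw
  have hwinj : Function.Injective (degreeOneMul 𝒮 w) := by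
    rw [← LinearMap.ker_eq_bot, LinearMap.ker_eq_bot']
    intro t ht
    have ht' : (w : S) * t = 0 := congrArg Subtype.val ht
    refine Subtype.ext (hf'.1 _ ?_)
    rw [← hw', mul_assoc, ht', mul_zero]
  have hwsurj : Function.Surjective (degreeOneMul 𝒮 w) := by
    let e := LinearEquiv.ofBijective _ (degreeOneMul_bijective hf hf' hy)
    have : Function.Surjective (e.symm.toLinearMap ∘ₗ degreeOneMul 𝒮 w) :=
      LinearMap.injective_iff_surjective.1 (e.symm.injective.comp hwinj)
    intro u
    obtain ⟨t, ht⟩ := this (e.symm u)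
    exact ⟨t, e.symm.injective ht⟩
  have hy' : ∀ s t : 𝒮 1, ∃ d : 𝒮 1, (y : S) * d = s * t := fun s t =>
    (hy (degreeOneMul 𝒮 s t)).imp fun d hd => congrArg Subtype.val hd
  rw [hS.irrelevant_eq_span, pow_succ, pow_two, Ideal.span_mul_span', Ideal.span_mul_span',
    Ideal.span_le]
  rintro _ ⟨_, ⟨a, ha, b, hb, rfl⟩, c, hc, rfl⟩
  obtain ⟨d, hd⟩ := hy' ⟨a, ha⟩ ⟨b, hb⟩
  obtain ⟨e, he⟩ := hy' d ⟨c, hc⟩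
  obtain ⟨e', he'⟩ := hwsurj (degreeOneMul 𝒮 y e)
  have he'' : (w : S) * e' = y * e := congrArg Subtype.val he'
  refine Ideal.mem_span_singleton.2 ⟨e', ?_⟩
  simp only at hd he ⊢
  rw [← hd, ← hw', mul_assoc, ← he, mul_assoc, he'']

/-- The augmentation of the quotient by a form of positive degree. -/
noncomputable def quotientAugmentation (hS : IsHomogeneousGradedRing 𝒮)
    (hf : f ∈ (HomogeneousIdeal.irrelevant 𝒮).toIdeal) : (S ⧸ Ideal.span {f}) →ₐ[k] k :=
  Ideal.Quotient.liftₐ (Ideal.span {f}) hS.augmentation fun _ hs =>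
    hS.augmentation_eq_zero_iff.2 ((Ideal.span_singleton_le_iff_mem _).2 hf hs)

/-- The components of degree one survive in the quotient by a quadratic form. -/
theorem coe_decompose_one_eq_zero_of_mem_span (hf : f ∈ 𝒮 2) {s : S} (hs : s ∈ Ideal.span {f}) :
    (decompose 𝒮 s 1 : S) = 0 := by
  obtain ⟨c, rfl⟩ := Ideal.mem_span_singleton.1 hs
  exact coe_decompose_mul_of_left_mem_of_not_le 𝒮 hf (by decide)

/-- The functional attached to `φ` sends the class of `s` to `φ` of the degree one component of `s`. -/
theorem isDegreeOnePart (hS : IsHomogeneousGradedRing 𝒮) (hf : f ∈ 𝒮 2)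
    (hf' : f ∈ nonZeroDivisors S) {y : 𝒮 1} (hy : Function.Surjective (degreeOneMul 𝒮 y)) :
    IsDegreeOnePart (hS.quotientAugmentation
      (HomogeneousIdeal.mem_irrelevant_of_mem 𝒮 two_pos hf)) (quotientDegreeOne 𝒮 f) where
  augmentation_eq_zero := by
    rintro _ ⟨s, hs, rfl⟩
    exact hS.augmentation_eq_zero_iff.2 (HomogeneousIdeal.mem_irrelevant_of_mem 𝒮 one_pos hs)
  exists_functional φ := by
    let T : 𝒮 1 →ₗ[k] quotientDegreeOne 𝒮 f :=
      (Ideal.Quotient.mkₐ k (Ideal.span {f})).toLinearMap.submoduleMap (𝒮 1)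
    let D : S →+ k :=
      { toFun := fun s => φ (T (decompose 𝒮 s 1))
        map_zero' := by simp
        map_add' := fun s t => by simp }
    have hD : (Ideal.Quotient.mk (Ideal.span {f})).toAddMonoidHom.ker ≤ D.ker := by
      intro s hs
      have h1 := coe_decompose_one_eq_zero_of_mem_span hf (Ideal.Quotient.eq_zero_iff_mem.1 hs)
      have h2 : decompose 𝒮 s 1 = 0 := Subtype.ext h1
      change φ (T (decompose 𝒮 s 1)) = 0
      rw [h2, map_zero, map_zero]
    refine ⟨AddMonoidHom.liftOfSurjective (Ideal.Quotient.mk (Ideal.span {f})).toAddMonoidHom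
      Ideal.Quotient.mk_surjective ⟨D, hD⟩, ?_⟩
    rintro r ⟨_, t, ht, rfl⟩
    obtain ⟨s, rfl⟩ := Ideal.Quotient.mk_surjective r
    have h1 := AddMonoidHom.liftOfRightInverse_comp_apply
      (Ideal.Quotient.mk (Ideal.span {f})).toAddMonoidHom _
      (Function.rightInverse_surjInv Ideal.Quotient.mk_surjective) ⟨D, hD⟩ (s * t)
    refine h1.trans ?_
    have h2 : decompose 𝒮 (s * t) 1 = hS.augmentation s • (⟨t, ht⟩ : 𝒮 1) := by
      apply Subtype.ext
      rw [coe_decompose_one_mul, decompose_of_mem_same 𝒮 ht,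
        decompose_of_mem_ne 𝒮 ht (show 1 ≠ 0 by decide), mul_zero, add_zero,
        ← hS.algebraMap_augmentation, ← Algebra.smul_def]
      rfl
    change φ (T (decompose 𝒮 (s * t) 1)) = _
    rw [h2, map_smul, map_smul]
    rfl
  isNilpotent_ker := by
    refine ⟨3, le_bot_iff.1 ?_⟩
    have h1 : RingHom.ker (hS.quotientAugmentation
        (HomogeneousIdeal.mem_irrelevant_of_mem 𝒮 two_pos hf)) ≤
        (HomogeneousIdeal.irrelevant 𝒮).toIdeal.map (Ideal.Quotient.mk (Ideal.span {f})) := by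
      intro r hr
      obtain ⟨s, rfl⟩ := Ideal.Quotient.mk_surjective r
      exact Ideal.mem_map_of_mem _ (hS.augmentation_eq_zero_iff.1 hr)
    refine (Ideal.pow_right_mono h1 3).trans ?_
    rw [← Ideal.map_pow, ← Ideal.map_quotient_self (Ideal.span {f})]
    exact Ideal.map_mono (hS.irrelevant_pow_three_le hf hf' hy)

end IsHomogeneousGradedRing

/-- Passing to the quotient by a quadratic form does not change the component of degree one. -/
noncomputable def degreeOneEquivQuotient (hf : f ∈ 𝒮 2) : 𝒮 1 ≃ₗ[k] quotientDegreeOne 𝒮 f :=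
  LinearEquiv.ofBijective ((Ideal.Quotient.mkₐ k (Ideal.span {f})).toLinearMap.submoduleMap (𝒮 1))
    ⟨by
      rw [← LinearMap.ker_eq_bot, LinearMap.ker_eq_bot']
      intro s hs
      have h1 : (s : S) ∈ Ideal.span {f} :=
        Ideal.Quotient.eq_zero_iff_mem.1 (congrArg Subtype.val hs)
      have h2 := IsHomogeneousGradedRing.coe_decompose_one_eq_zero_of_mem_span hf h1
      rw [decompose_of_mem_same 𝒮 s.2] at h2
      exact Subtype.ext h2, LinearMap.submoduleMap_surjective _ _⟩

theorem mk_degreeOneEquivQuotient_symm (hf : f ∈ 𝒮 2) (v : quotientDegreeOne 𝒮 f) :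
    Ideal.Quotient.mk (Ideal.span {f}) ((degreeOneEquivQuotient hf).symm v : S) = v :=
  congrArg Subtype.val ((degreeOneEquivQuotient hf).apply_symm_apply v)

end Graded

/-! ### The family of modules -/

theorem mainTheorem3 {k : Type v} {S : Type u} [Field k] [IsAlgClosed k] [CommRing S] [Algebra k S]
    (𝒮 : ℕ → Submodule k S) [GradedAlgebra 𝒮]
    (hS : IsHomogeneousGradedRing 𝒮) (hCM : IsCohenMacaulayRing S)
    (hdim : ringKrullDim S = 1) (hmult : HasGradedMinimalMultiplicity 𝒮)
    (f : S) (hf : f ∈ 𝒮 2) (hf' : f ∈ nonZeroDivisors S)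
    (hV : 2 ≤ Module.finrank k (quotientDegreeOne 𝒮 f))
    (z : quotientDegreeOne 𝒮 f) (hz : z ≠ 0) :
    ∃ O : Set (ℙ k (quotientDegreeOne 𝒮 f)),
      IsOpen[zariskiTopology k (quotientDegreeOne 𝒮 f)] O ∧ O.Nonempty ∧
      ∃ M : O → ℕ+ → ModuleCat.{u} (S ⧸ Ideal.span {f}),
        (∀ (p : O) (n : ℕ+) (x : quotientDegreeOne 𝒮 f) (hx : x ≠ 0),
          Projectivization.mk k x hx = p.1 →
          Nonempty (M p n ≃ₗ[S ⧸ Ideal.span {f}]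
            matrixCokernel (bidiagonal (x : S ⧸ Ideal.span {f}) (z : S ⧸ Ideal.span {f}) n))) ∧
        (∀ (p : O) (n : ℕ+),
          IsIndecomposableModule (S ⧸ Ideal.span {f}) (M p n) ∧
          IsMinimallyGeneratedBy (S ⧸ Ideal.span {f}) (M p n) n) ∧
        (∀ (p : O) (n : ℕ+), HasGDimZero (S ⧸ Ideal.span {f}) (M p n)) ∧
        (∀ (p p' : O) (n n' : ℕ+), (p, n) ≠ (p', n') →
          IsEmpty (M p n ≃ₗ[S ⧸ Ideal.span {f}] M p' n')) := by
  have := hS.finite_degree_one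
  have : Infinite k := IsAlgClosed.instInfinite
  obtain ⟨hprime, hmult⟩ := hmult
  obtain ⟨y₀, hy₀, hy₀'⟩ := hS.exists_degree_two_le hdim.le rfl hmult
  have hsurj : Function.Surjective (degreeOneMul 𝒮 ⟨y₀, hy₀⟩) := fun u => by
    obtain ⟨t, ht, h⟩ := hy₀' u u.2
    exact ⟨⟨t, ht⟩, Subtype.ext h.symm⟩
  have hpart := hS.isDegreeOnePart hf hf' hsurj
  let L := degreeOneEquivQuotient (k := k) (𝒮 := 𝒮) hf
  let e := LinearEquiv.ofBijective _ (degreeOneMul_bijective hf hf' hsurj)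
  -- Multiplication by `x`, followed by the inverse of multiplication by the fixed form `y₀`.
  let B : quotientDegreeOne 𝒮 f →ₗ[k] Module.End k (𝒮 1) :=
    (LinearMap.llcomp k (𝒮 1) (𝒮 2) (𝒮 1) e.symm.toLinearMap) ∘ₗ degreeOneMul 𝒮 ∘ₗ
      L.symm.toLinearMap
  have hB : ∀ v, IsUnit (B v) → Function.Surjective (degreeOneMul 𝒮 (L.symm v)) := by
    intro v hv u
    obtain ⟨t, ht⟩ := ((Module.End.isUnit_iff _).1 hv).2 (e.symm u)
    exact ⟨t, e.symm.injective ht⟩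
  have hB₀ : B (L ⟨y₀, hy₀⟩) = 1 := by
    refine LinearMap.ext fun t => ?_
    change e.symm (degreeOneMul 𝒮 (L.symm (L ⟨y₀, hy₀⟩)) t) = t
    rw [L.symm_apply_apply]
    exact e.symm_apply_apply t
  refine ⟨{p | IsUnit (B p.rep)} ∩ {p | p ≠ Projectivization.mk k z hz}, ?_, ?_, ?_⟩
  · let _ : TopologicalSpace (ℙ k (quotientDegreeOne 𝒮 f)) := zariskiTopology k _
    exact (isOpen_zariskiTopology_isUnit B).inter (isOpen_zariskiTopology_ne z hz)
  · obtain ⟨x, hx, hxz⟩ := exists_isUnit_notMem_span B hB₀ hV hz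
    have hx0 : x ≠ 0 := fun h => hxz (h ▸ zero_mem _)
    refine ⟨Projectivization.mk k x hx0, ?_, ?_⟩
    · obtain ⟨a, ha⟩ := Projectivization.exists_smul_eq_mk_rep k x hx0
      rw [Set.mem_ofPred_eq, ← ha, Units.smul_def, map_smul]
      exact hx.smul a
    · rwa [Set.mem_ofPred_eq, ne_eq, Projectivization.mk_eq_mk_iff_mem_span]
  have hrep : ∀ p : ℙ k (quotientDegreeOne 𝒮 f), p ≠ Projectivization.mk k z hz →
      p.rep ∉ Submodule.span k {z} ∧ z ∉ Submodule.span k {p.rep} := by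
    intro p hp
    rw [← Projectivization.mk_eq_mk_iff_mem_span p.rep_nonzero hz,
      ← Projectivization.mk_eq_mk_iff_mem_span hz p.rep_nonzero, p.mk_rep]
    exact ⟨hp, hp.symm⟩
  refine ⟨fun p n => ModuleCat.of _ (matrixCokernel (bidiagonal
    (p.1.rep : S ⧸ Ideal.span {f}) (z : S ⧸ Ideal.span {f}) n)), ?_, ?_, ?_, ?_⟩
  · rintro p n x hx hxp
    obtain ⟨a, ha⟩ := Projectivization.exists_smul_eq_mk_rep k x hx
    have h1 : (p.1.rep : S ⧸ Ideal.span {f}) = algebraMap k _ (a : k) * x := by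
      rw [← hxp, ← ha, ← Algebra.smul_def]
      rfl
    obtain ⟨e⟩ := nonempty_cokernel_bidiagonal_equiv (a.isUnit.map (algebraMap k _))
      (x : S ⧸ Ideal.span {f}) (z : S ⧸ Ideal.span {f}) n
    rw [← h1] at e
    exact ⟨e.symm⟩
  · exact fun p n => ⟨hpart.isIndecomposableModule n.pos (hrep p p.2.2).1 (hrep p p.2.2).2,
      hpart.isMinimallyGeneratedBy _ _ _⟩
  · intro p n
    have h := hasGDimZero_cokernel_bidiagonal hf hf' (hB _ p.2.1) (L.symm z) n
    rwa [mk_degreeOneEquivQuotient_symm, mk_degreeOneEquivQuotient_symm] at h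
  · refine fun p p' n n' hne => ⟨fun e => hne ?_⟩
    have hn : n = n' := PNat.coe_injective
      ((hpart.isMinimallyGeneratedBy _ _ _).congr (hpart.isMinimallyGeneratedBy _ _ _) e)
    subst hn
    have h := hpart.mem_span_of_equiv n.pos (hrep p p.2.2).1 e
    rw [← Projectivization.mk_eq_mk_iff_mem_span p'.1.rep_nonzero p.1.rep_nonzero,
      Projectivization.mk_rep, Projectivization.mk_rep] at h
    rw [Subtype.ext h]
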